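/- Let $G$ be a finite group. Let $F(G)$ be the Fitting subgroup of $G$, i.e. its largest nilpotent normal subgroup, and let $F^*(G)$ be the quasinilpotent radical of $G$, i.e. the subgroup with $F(G)\le F^*(G)\le C_G(F(G))F(G)$ defined by $$F^*(G)/F(G)=\mathrm{Soc}\bigl(C_G(F(G))F(G)/F(G)\bigr),$$ where $\mathrm{Soc}(H)$ denotes the socle of a group $H$, the subgroup generated by all minimal normal subgroups of $H$. Then $G$ is nilpotent if and only if $F^*(G)\le N_G(P)$ for every prime $p$ and every Sylow $p$-subgroup $P$ of $G$. -/

import Mathlib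

namespace FittingTheory

/-- The Fitting subgroup `F(G)`: the subgroup generated by all nilpotent normal subgroups of `G`.
For a finite group it is the unique largest nilpotent normal subgroup. -/
def fittingSubgroup (G : Type*) [Group G] : Subgroup G :=
  sSup {N : Subgroup G | N.Normal ∧ Group.IsNilpotent N}

instance fittingSubgroup_normal (G : Type*) [Group G] : (fittingSubgroup G).Normal :=
  Subgroup.sSup_normal _ fun _ hN => hN.1

/-- `N` is a minimal normal subgroup of `G`: it is minimal (for inclusion) among the nontrivial
normal subgroups of `G`. -/
def IsMinimalNormal {G : Type*} [Group G] (N : Subgroup G) : Prop :=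
  Minimal (fun H : Subgroup G => H.Normal ∧ H ≠ ⊥) N

/-- The socle `Soc(G)`: the subgroup generated by all minimal normal subgroups of `G`. -/
def socle (G : Type*) [Group G] : Subgroup G :=
  sSup {N : Subgroup G | IsMinimalNormal N}

/-- The subgroup `C_G(F(G)) F(G)` of `G`. Both factors are normal, so their product set is the
subgroup that they generate. -/
def fittingCentralizerProduct (G : Type*) [Group G] : Subgroup G :=
  Subgroup.centralizer (fittingSubgroup G : Set G) ⊔ fittingSubgroup G

/-- The quasinilpotent radical `F*(G)`: the subgroup with `F(G) ≤ F*(G) ≤ C_G(F(G)) F(G)` and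
`F*(G) / F(G) = Soc(C_G(F(G)) F(G) / F(G))`, that is, the full preimage of the socle of the group
`C_G(F(G)) F(G) / F(G)` in `C_G(F(G)) F(G)`, regarded as a subgroup of `G`. -/
def quasinilpotentRadical (G : Type*) [Group G] : Subgroup G :=
  ((socle (fittingCentralizerProduct G ⧸
      (fittingSubgroup G).subgroupOf (fittingCentralizerProduct G))).comap
    (QuotientGroup.mk' ((fittingSubgroup G).subgroupOf (fittingCentralizerProduct G)))).map
    (fittingCentralizerProduct G).subtype

end FittingTheory

/-!
The forward direction holds because the Sylow subgroups of a nilpotent group are normal.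

Conversely, let `F = F(G)` and `K = F*(G)`, and suppose that `K` normalizes every Sylow subgroup
of `G`. A Sylow subgroup of `K` is the intersection of `K` with a Sylow subgroup of `G`, so it is
normal in `K`, and `K` is nilpotent (`isNilpotent_of_le_normalizer_sylow`). As `K` is normal in `G`,
this forces `K = F`, so the socle of `C_G(F) F / F` is trivial. A nontrivial finite group has a
nontrivial socle, hence `C_G(F) ≤ F` (`centralizer_le_of_quasinilpotentRadical_le`).

It remains to see that `G` is nilpotent whenever it has a nilpotent normal subgroup `K` which
contains its centralizer and normalizes all Sylow subgroups
(`isNilpotent_of_centralizer_le_of_le_normalizer_sylow`). Let `P` be a Sylow `p`-subgroup. If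
`r ≠ p`, the Sylow `r`-subgroup `R` of `K` is normal in `G` and normalizes `P`, so
`[P, R] ≤ P ∩ R = 1`. If `Q` is a Sylow `q`-subgroup with `q ≠ p`, each Sylow subgroup of `K` is
therefore centralized by `P` or by `Q`, hence by `[P, Q]`; that is, `[P, Q] ≤ C_G(K)`. So `P C_G(K)`
is normalized by a Sylow subgroup for every prime and is normal in `G`. Since
`C_G(K) ≤ K ≤ N_G(P)`, the Frattini argument applied to `P C_G(K)` shows that `P` is normal in `G`.
-/

namespace FittingTheory

open Subgroup
open scoped commutatorElement

variable {G : Type*} [Group G]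

/-! ### Sylow subgroups -/

theorem eq_top_of_forall_exists_sylow_le [Finite G] (H : Subgroup G)
    (h : ∀ (p : ℕ) [Fact p.Prime], ∃ P : Sylow p G, (P : Subgroup G) ≤ H) : H = ⊤ := by
  refine Subgroup.eq_top_of_le_card H (Nat.le_of_dvd Nat.card_pos ?_)
  rw [Nat.dvd_iff_prime_pow_dvd_dvd]
  intro p k hp hk
  have : Fact p.Prime := ⟨hp⟩
  obtain ⟨P, hP⟩ := h p
  refine dvd_trans ?_ (Subgroup.card_dvd_of_le hP)
  rw [Sylow.card_eq_multiplicity]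
  exact pow_dvd_pow p ((hp.pow_dvd_iff_le_factorization Nat.card_pos.ne').1 hk)

theorem isNilpotent_iff_forall_sylow_normal [Finite G] :
    Group.IsNilpotent G ↔ ∀ (p : ℕ) [Fact p.Prime] (P : Sylow p G), (P : Subgroup G).Normal :=
  Group.isNilpotent_of_finite_tfae.out 0 3 rfl rfl

theorem isNilpotent_of_le_normalizer_sylow [Finite G] (H : Subgroup G)
    (h : ∀ (p : ℕ) [Fact p.Prime] (P : Sylow p G), H ≤ normalizer (P : Set G)) :
    Group.IsNilpotent H := by
  rw [isNilpotent_iff_forall_sylow_normal]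
  intro p _ R
  obtain ⟨P, hP⟩ := R.exists_comap_subtype_eq
  rw [← hP]
  refine ⟨fun n hn g => ?_⟩
  exact (mem_normalizer_iff.1 (h p P g.2) n).1 hn

/-! ### The quasinilpotent radical -/

theorem IsMinimalNormal.map_equiv {H : Type*} [Group H] (e : G ≃* H) {N : Subgroup G}
    (hN : IsMinimalNormal N) : IsMinimalNormal (N.map e.toMonoidHom) := by
  refine ⟨⟨hN.prop.1.map _ e.surjective, fun h => hN.prop.2 ?_⟩, fun M hM hle => ?_⟩
  · exact (map_eq_bot_iff_of_injective N e.injective).1 h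
  · have := hM.1
    rw [Subgroup.map_le_iff_le_comap]
    refine hN.le_of_le ⟨inferInstance, fun h => hM.2 ?_⟩ ?_
    · rw [← map_comap_eq_self_of_surjective (f := e.toMonoidHom) e.surjective M, h,
        Subgroup.map_bot]
    · exact (comap_mono hle).trans (comap_map_eq_self_of_injective e.injective N).le

theorem map_socle_le {H : Type*} [Group H] (e : G ≃* H) :
    (socle G).map e.toMonoidHom ≤ socle H := by
  rw [Subgroup.map_le_iff_le_comap]
  refine sSup_le fun N hN => ?_
  rw [← Subgroup.map_le_iff_le_comap]
  exact le_sSup (IsMinimalNormal.map_equiv e hN)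

theorem socle_ne_bot [Finite G] [Nontrivial G] : socle G ≠ ⊥ := by
  obtain ⟨N, -, hN⟩ := (Set.toFinite {H : Subgroup G | H.Normal ∧ H ≠ ⊥}).exists_le_minimal
    (a := ⊤) ⟨inferInstance, top_ne_bot⟩
  intro h
  exact hN.prop.2 (le_bot_iff.1 (h ▸ le_sSup (a := N) (s := {N | IsMinimalNormal N}) hN))

theorem le_fittingSubgroup {N : Subgroup G} (hN : N.Normal) (h : Group.IsNilpotent N) :
    N ≤ fittingSubgroup G :=
  le_sSup ⟨hN, h⟩

instance fittingCentralizerProduct_normal : (fittingCentralizerProduct G).Normal := by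
  unfold fittingCentralizerProduct; infer_instance

theorem fittingSubgroup_le_quasinilpotentRadical :
    fittingSubgroup G ≤ quasinilpotentRadical G := by
  intro x hx
  have hD : x ∈ fittingCentralizerProduct G := (le_sup_right : fittingSubgroup G ≤ _) hx
  refine ⟨⟨x, hD⟩, ?_, rfl⟩
  rw [SetLike.mem_coe, mem_comap, QuotientGroup.mk'_apply,
    (QuotientGroup.eq_one_iff (⟨x, hD⟩ : fittingCentralizerProduct G)).2 hx]
  exact one_mem _

/-- Conjugation by an element of `G` induces an automorphism of `C_G(F(G)) F(G) / F(G)`, which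
preserves the socle. -/
instance quasinilpotentRadical_normal : (quasinilpotentRadical G).Normal := by
  refine ⟨?_⟩
  rintro _ ⟨x, hx, rfl⟩ g
  let D := fittingCentralizerProduct G
  let F := (fittingSubgroup G).subgroupOf D
  let c : D ≃* D := MulAut.conjNormal g
  have hc : F.map (c : D →* D) = F := by
    ext y
    refine Subgroup.mem_map_equiv.trans ?_
    rw [mem_subgroupOf, mem_subgroupOf, MulAut.conjNormal_symm_apply,
      (fittingSubgroup_normal G).mem_comm_iff, mul_inv_cancel_left]
  let e : D ⧸ F ≃* D ⧸ F := QuotientGroup.congr F F c hc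
  refine ⟨c x, ?_, MulAut.conjNormal_apply g x⟩
  exact map_socle_le e ⟨(x : D ⧸ F), hx, rfl⟩

theorem centralizer_le_of_quasinilpotentRadical_le [Finite G]
    (h : quasinilpotentRadical G ≤ fittingSubgroup G) :
    centralizer (fittingSubgroup G : Set G) ≤ fittingSubgroup G := by
  suffices hD : fittingCentralizerProduct G ≤ fittingSubgroup G from le_sup_left.trans hD
  by_contra hD
  let D := fittingCentralizerProduct G
  let F := (fittingSubgroup G).subgroupOf D
  have : Nontrivial (D ⧸ F) :=
    QuotientGroup.nontrivial_iff.2 fun hF => hD (subgroupOf_eq_top.1 hF)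
  refine socle_ne_bot (G := D ⧸ F) ((eq_bot_iff_forall _).2 fun x hx => ?_)
  obtain ⟨y, rfl⟩ := QuotientGroup.mk_surjective x
  exact (QuotientGroup.eq_one_iff y).2 (h ⟨y, hx, rfl⟩)

/-! ### Self-centralizing nilpotent normal subgroups -/

/-- The normal `r`-subgroup `R` and the `p`-subgroup `P` normalize each other and intersect
trivially. -/
theorem le_centralizer_of_le_normalizer_of_ne {p r : ℕ} [Fact p.Prime] [Fact r.Prime] (hpr : p ≠ r)
    {P R : Subgroup G} (hP : IsPGroup p P) (hR : IsPGroup r R) [R.Normal]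
    (h : R ≤ normalizer (P : Set G)) : P ≤ centralizer (R : Set G) := by
  intro x hx
  rw [mem_centralizer_iff]
  intro y hy
  have h1 : y * x * y⁻¹ * x⁻¹ ∈ P :=
    mul_mem ((mem_normalizer_iff.1 (h hy) x).1 hx) (inv_mem hx)
  have h2 : y * x * y⁻¹ * x⁻¹ ∈ R := by
    have := mul_mem hy (Normal.conj_mem ‹R.Normal› _ (inv_mem hy) x)
    simpa only [mul_assoc] using this
  have h3 := disjoint_iff_inf_le.1 (IsPGroup.disjoint_of_ne p r hpr P R hP hR) ⟨h1, h2⟩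
  rw [mem_bot, mul_inv_eq_one, mul_inv_eq_iff_eq_mul] at h3
  exact h3

theorem commutator_sylow_le_centralizer [Finite G] {K : Subgroup G} [K.Normal]
    (hK : Group.IsNilpotent K)
    (h : ∀ (p : ℕ) [Fact p.Prime] (P : Sylow p G), K ≤ normalizer (P : Set G))
    {p q : ℕ} [Fact p.Prime] [Fact q.Prime] (hpq : p ≠ q) (P : Sylow p G) (Q : Sylow q G) :
    ⁅(P : Subgroup G), (Q : Subgroup G)⁆ ≤ centralizer (K : Set G) := by
  rw [le_centralizer_iff, ← subgroupOf_eq_top]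
  refine eq_top_of_forall_exists_sylow_le _ fun r _ => ?_
  let R : Sylow r K := default
  have : (R : Subgroup K).Normal := isNilpotent_iff_forall_sylow_normal.1 hK r R
  have : (R : Subgroup K).Characteristic := R.characteristic_of_normal this
  let S : Subgroup G := (R : Subgroup K).map K.subtype
  have hS : IsPGroup r S := R.isPGroup'.map _
  have hSK : S ≤ K := map_subtype_le _
  refine ⟨R, ?_⟩
  rw [subgroupOf, ← Subgroup.map_le_iff_le_comap, ← le_centralizer_iff]
  by_cases hpr : p = r
  · have hQ := le_centralizer_of_le_normalizer_of_ne (fun hqr => hpq (hpr.trans hqr.symm))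
      Q.isPGroup' hS (hSK.trans (h q Q))
    exact (commutator_mono le_rfl hQ).trans (commutator_le_right _ _)
  · have hP := le_centralizer_of_le_normalizer_of_ne hpr P.isPGroup' hS (hSK.trans (h p P))
    exact (commutator_mono hP le_rfl).trans (commutator_le_left _ _)

theorem isNilpotent_of_centralizer_le_of_le_normalizer_sylow [Finite G] {K : Subgroup G} [K.Normal]
    (hK : Group.IsNilpotent K) (hC : centralizer (K : Set G) ≤ K)
    (h : ∀ (p : ℕ) [Fact p.Prime] (P : Sylow p G), K ≤ normalizer (P : Set G)) :
    Group.IsNilpotent G := by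
  rw [isNilpotent_iff_forall_sylow_normal]
  intro p _ P
  let M : Subgroup G := P ⊔ centralizer (K : Set G)
  have hM : M ≤ normalizer (P : Set G) := sup_le le_normalizer (hC.trans (h p P))
  have hMn : normalizer (M : Set G) = ⊤ := by
    refine eq_top_of_forall_exists_sylow_le _ fun q _ => ?_
    by_cases hpq : p = q
    · subst hpq
      exact ⟨P, le_sup_left.trans le_normalizer⟩
    · let Q : Sylow q G := default
      refine ⟨Q, ?_⟩
      have hPQ := commutator_sylow_le_centralizer hK h hpq P Q
      have hconj : ∀ y ∈ (Q : Subgroup G), ∀ x ∈ M, y * x * y⁻¹ ∈ M := by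
        intro y hy
        suffices hle : M ≤ M.comap (MulAut.conj y).toMonoidHom from fun x hx => hle hx
        refine sup_le (fun x hx => ?_) fun x hx => ?_
        · have h1 : ⁅x, y⁆ ∈ M := (le_sup_right : _ ≤ M) (hPQ (commutator_mem_commutator hx hy))
          have h2 : x ∈ M := (le_sup_left : _ ≤ M) hx
          have h3 := mul_mem (inv_mem h1) h2
          simpa [commutatorElement_def, mul_assoc] using h3
        · exact (le_sup_right : _ ≤ M) (Normal.conj_mem inferInstance x hx y)
      intro y hy
      rw [mem_normalizer_iff]
      refine fun x => ⟨hconj y hy x, fun hx => ?_⟩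
      have := hconj y⁻¹ (inv_mem hy) _ hx
      simpa [mul_assoc] using this
  have : M.Normal := normalizer_eq_top_iff.1 hMn
  have hF := P.normalizer_sup_eq_top' (N := M) le_sup_left
  rw [sup_eq_left.2 hM] at hF
  exact normalizer_eq_top_iff.1 hF

end FittingTheory

theorem corollary4p4 (G : Type*) [Group G] [Finite G] :
    Group.IsNilpotent G ↔
      ∀ (p : ℕ) [Fact p.Prime] (P : Sylow p G),
        FittingTheory.quasinilpotentRadical G ≤ Subgroup.normalizer (P : Set G) := by
  refine ⟨fun h p _ P => ?_, fun h => ?_⟩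
  · have := FittingTheory.isNilpotent_iff_forall_sylow_normal.1 h p P
    exact le_top.trans (Subgroup.normalizer_eq_top_iff.2 this).ge
  · have hK := FittingTheory.isNilpotent_of_le_normalizer_sylow _ h
    have hKF := FittingTheory.le_fittingSubgroup inferInstance hK
    have hFK := FittingTheory.fittingSubgroup_le_quasinilpotentRadical (G := G)
    refine FittingTheory.isNilpotent_of_centralizer_le_of_le_normalizer_sylow hK ?_ h
    exact (Subgroup.centralizer_le hFK).trans
      ((FittingTheory.centralizer_le_of_quasinilpotentRadical_le hKF).trans hFK)
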